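/- Let $X$ be a real Hausdorff locally convex space with topological dual $X^*$. On $\overline{\mathbb R}=\mathbb R\cup\{-\infty,+\infty\}$ use the conventions $(+\infty)+(-\infty)=(-\infty)+(+\infty)=+\infty$, $0\cdot(+\infty)=+\infty$, $0\cdot(-\infty)=0$. For $g:X\to\overline{\mathbb R}$ put $\operatorname{dom} g=\{x\in X: g(x)<+\infty\}$ and $\operatorname{epi} g=\{(x,r)\in X\times\mathbb R: g(x)\le r\}$; $g$ is convex (respectively lower semicontinuous) if $\operatorname{epi} g$ is convex (respectively closed), and proper if $\operatorname{dom} g\ne\emptyset$ and $g>-\infty$ on $X$. For $\eta\in\overline{\mathbb R}$ and $x\in X$ let $$\partial_\eta g(x)=\{x^*\in X^*: g(y)\ge g(x)+\langle x^*,y-x\rangle-\eta\ \text{ for all } y\in X\}$$ if $x\in\operatorname{dom} g$ and $\eta\ge 0$, let $\partial_\eta g(x)=\emptyset$ otherwise, and write $\partial g(x)=\partial_0 g(x)$. Let $n\ge 1$, let $f_1,\dots,f_n:X\to\overline{\mathbb R}$ be convex functions, let $f=\max_{1\le k\le n} f_k$, and suppose that $\operatorname{dom} f\neq\emptyset$.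 Assume that all the $f_k$ are proper, or that all the $f_k$ are lower semicontinuous. Let $\Delta_n=\{\lambda\in\mathbb R^n:\lambda_k\ge 0,\ \sum_{k=1}^n\lambda_k=1\}$ and, for $\lambda\in\Delta_n$, $f_\lambda=\sum_{k=1}^n\lambda_k f_k$. Then for every $x\in X$ and every real $\varepsilon\ge 0$, $$\partial_\varepsilon f(x)=\bigcup_{\lambda\in\Delta_n}\partial_{\varepsilon+f_\lambda(x)-f(x)}\,f_\lambda(x).$$ In particular, for every $x\in X$, $$\partial f(x)=\bigcup\{\partial f_\lambda(x):\ \lambda\in\Delta_n,\ f_\lambda(x)=f(x)\}.$$ -/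

import Mathlib

namespace MaxSubdiff

/-- Addition on the extended reals with the convention `(+∞) + (-∞) = (-∞) + (+∞) = +∞`
(the addition of `EReal` in Mathlib has the opposite convention). -/
noncomputable def eadd (a b : EReal) : EReal :=
  open Classical in if a = ⊤ ∨ b = ⊤ then ⊤ else a + b

/-- Multiplication of an extended real by a real with the conventions
`0 · (+∞) = +∞` and `0 · (-∞) = 0`. -/
noncomputable def esmul (t : ℝ) (a : EReal) : EReal :=
  open Classical in if t = 0 ∧ a = ⊤ then ⊤ else (t : EReal) * a

theorem eadd_eq_top {a b : EReal} : eadd a b = ⊤ ↔ a = ⊤ ∨ b = ⊤ := by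
  unfold eadd
  split_ifs with h
  · simp [h]
  · push Not at h
    simp [h.1, h.2, EReal.add_ne_top h.1 h.2]

instance instCommutativeEadd : Std.Commutative eadd :=
  ⟨fun a b => by simp only [eadd, or_comm, add_comm]⟩

instance instAssociativeEadd : Std.Associative eadd :=
  ⟨fun a b c => by
    by_cases h : a = ⊤ ∨ b = ⊤ ∨ c = ⊤
    · rw [eadd_eq_top.2 (by rw [eadd_eq_top]; tauto), eadd_eq_top.2 (by rw [eadd_eq_top]; tauto)]
    · push Not at h
      obtain ⟨ha, hb, hc⟩ := h
      simp [eadd, ha, hb, hc, EReal.add_ne_top, add_assoc]⟩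

section Functions

variable {X : Type*}

/-- The effective domain. -/
def edom (f : X → EReal) : Set X := {x | f x < ⊤}

/-- The epigraph, a subset of `X × ℝ`. -/
def epi (f : X → EReal) : Set (X × ℝ) := {p | f p.1 ≤ (p.2 : EReal)}

/-- Properness: non-empty effective domain, and the value `-∞` is not taken. -/
def IsProper (f : X → EReal) : Prop := (edom f).Nonempty ∧ ∀ x, ⊥ < f x

/-- Convexity: the epigraph is convex. -/
def IsConvexFun [AddCommGroup X] [Module ℝ X] (f : X → EReal) : Prop := Convex ℝ (epi f)

/-- Lower semicontinuity: the epigraph is closed. -/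
def IsLsc [TopologicalSpace X] (f : X → EReal) : Prop := IsClosed (epi f)

/-- The pointwise maximum `max_k f_k` of a finite family. -/
noncomputable def maxFun {n : ℕ} (f : Fin n → X → EReal) (x : X) : EReal := ⨆ k, f k x

/-- The combination `∑_k l_k f_k`, computed with the operations `eadd` and `esmul`. -/
noncomputable def combFun {n : ℕ} (f : Fin n → X → EReal) (l : Fin n → ℝ) (x : X) : EReal :=
  Finset.univ.fold eadd 0 (fun k => esmul (l k) (f k x))

/-- The `ε`-subdifferential of `f` at `x`: the continuous linear functionals `p` with
`f y ≥ f x + p (y - x) - ε` for all `y`; it is empty if `f x = +∞` or `ε < 0`.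
The parameter `ε` is an extended real. -/
def epsSubdiff [AddCommGroup X] [Module ℝ X] [TopologicalSpace X]
    (ε : EReal) (f : X → EReal) (x : X) : Set (X →L[ℝ] ℝ) :=
  {p | x ∈ edom f ∧ 0 ≤ ε ∧ ∀ y, eadd (eadd (f x) ((p (y - x) : ℝ) : EReal)) (-ε) ≤ f y}

/-- The subdifferential. -/
def subdiff [AddCommGroup X] [Module ℝ X] [TopologicalSpace X]
    (f : X → EReal) (x : X) : Set (X →L[ℝ] ℝ) :=
  epsSubdiff 0 f x

end Functions

end MaxSubdiff

namespace MaxSubdiff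

/-! If `f x = c` is real, membership of `p` on either side says that the affine function `a y = c +
p (y - x) - ε` minorizes `f`, respectively some `f_λ`: the value `f_λ x` cancels on the right. Since
`f_λ ≤ f`, what remains is that an affine minorant of the maximum minorizes some `f_λ`
(`exists_stdSimplex_le_combFun`). The vectors lying above some `(f_k y - a y)_k` form a convex set
missing the open negative orthant, and separation in `ℝⁿ` gives `λ`. If `f x = ±∞`, then `f_λ x = f
x` by the conventions, and both sides are empty or everything. -/

theorem eadd_of_ne_top {a b : EReal} (ha : a ≠ ⊤) (hb : b ≠ ⊤) : eadd a b = a + b := by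
  simp [eadd, ha, hb]

theorem eadd_coe (a b : ℝ) : eadd (a : EReal) (b : EReal) = ((a + b : ℝ) : EReal) := by
  rw [eadd_of_ne_top (EReal.coe_ne_top a) (EReal.coe_ne_top b), EReal.coe_add]

theorem eadd_bot {b : EReal} (hb : b ≠ ⊤) : eadd ⊥ b = ⊥ := by
  rw [eadd_of_ne_top bot_ne_top hb, EReal.bot_add]

theorem esmul_top {t : ℝ} (ht : 0 ≤ t) : esmul t ⊤ = ⊤ := by
  rcases ht.eq_or_lt with h | h
  · simp [esmul, ← h]
  · simp [esmul, h.ne', EReal.coe_mul_top_of_pos h]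

theorem esmul_of_ne_top {t : ℝ} {a : EReal} (ha : a ≠ ⊤) : esmul t a = (t : EReal) * a := by
  simp [esmul, ha]

theorem coe_mul_ne_top {t : ℝ} (ht : 0 ≤ t) {a : EReal} (ha : a ≠ ⊤) :
    (t : EReal) * a ≠ ⊤ := by
  induction a with
  | bot =>
    rcases ht.eq_or_lt with h | h
    · simp [← h]
    · simp [EReal.coe_mul_bot_of_pos h]
  | coe a => rw [← EReal.coe_mul]; exact EReal.coe_ne_top _
  | top => exact absurd rfl ha

theorem sum_ne_top {ι : Type*} (s : Finset ι) (g : ι → EReal) (h : ∀ i ∈ s, g i ≠ ⊤) :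
    ∑ i ∈ s, g i ≠ ⊤ :=
  Finset.sum_induction g (· ≠ ⊤) (fun _ _ => EReal.add_ne_top) EReal.zero_ne_top h

theorem sum_eq_bot {ι : Type*} (s : Finset ι) (g : ι → EReal) {i : ι} (hi : i ∈ s)
    (h : g i = ⊥) : ∑ i ∈ s, g i = ⊥ := by
  classical
  rw [← Finset.add_sum_erase s g hi, h, EReal.bot_add]

theorem fold_eadd_eq_sum {ι : Type*} (s : Finset ι) (g : ι → EReal) (h : ∀ i ∈ s, g i ≠ ⊤) :
    s.fold eadd 0 g = ∑ i ∈ s, g i := by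
  classical
  induction s using Finset.induction_on with
  | empty => simp
  | insert i s hi ih =>
    have hs : ∀ j ∈ s, g j ≠ ⊤ := fun j hj => h j (Finset.mem_insert_of_mem hj)
    rw [Finset.fold_insert hi, Finset.sum_insert hi, ih hs,
      eadd_of_ne_top (h i (Finset.mem_insert_self i s)) (sum_ne_top s g hs)]

/-! ### Convex combinations with extended real values -/

section Combination

variable {X : Type*} {n : ℕ} {f : Fin n → X → EReal} {l : Fin n → ℝ}

/-- This is where `0 · (+∞) = +∞` matters: even a zero weight lets `+∞` through. -/
theorem combFun_eq_top (hl : ∀ k, 0 ≤ l k) {y : X} {k : Fin n} (hk : f k y = ⊤) :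
    combFun f l y = ⊤ := by
  classical
  rw [combFun, ← Finset.insert_erase (Finset.mem_univ k),
    Finset.fold_insert (Finset.notMem_erase _ _), hk, esmul_top (hl k)]
  exact eadd_eq_top.2 (Or.inl rfl)

theorem combFun_eq_sum (hl : ∀ k, 0 ≤ l k) {y : X} (h : ∀ k, f k y ≠ ⊤) :
    combFun f l y = ∑ k, (l k : EReal) * f k y := by
  have hterm : ∀ k, esmul (l k) (f k y) = (l k : EReal) * f k y :=
    fun k => esmul_of_ne_top (h k)
  simp only [combFun, hterm]
  exact fold_eadd_eq_sum _ _ fun k _ => coe_mul_ne_top (hl k) (h k)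

theorem coe_sum_ereal {ι : Type*} (s : Finset ι) (g : ι → ℝ) :
    ((∑ i ∈ s, g i : ℝ) : EReal) = ∑ i ∈ s, (g i : EReal) := by
  classical
  induction s using Finset.induction_on with
  | empty => simp
  | insert i s hi ih => rw [Finset.sum_insert hi, Finset.sum_insert hi, EReal.coe_add, ih]

theorem exists_pos_of_mem_stdSimplex (hl : l ∈ stdSimplex ℝ (Fin n)) : ∃ k, 0 < l k := by
  by_contra! h
  have := Finset.sum_nonpos fun k (_ : k ∈ Finset.univ) => h k
  linarith [hl.2]

theorem combFun_eq_bot (hl : ∀ k, 0 ≤ l k) {y : X} (h : ∀ k, f k y ≠ ⊤) {k : Fin n}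
    (hk : 0 < l k) (hb : f k y = ⊥) : combFun f l y = ⊥ := by
  rw [combFun_eq_sum hl h]
  exact sum_eq_bot _ _ (Finset.mem_univ k) (by rw [hb, EReal.coe_mul_bot_of_pos hk])

theorem le_maxFun (k : Fin n) (y : X) : f k y ≤ maxFun f y := le_iSup (fun k => f k y) k

theorem ne_top_of_maxFun_ne_top {y : X} (h : maxFun f y ≠ ⊤) (k : Fin n) : f k y ≠ ⊤ :=
  ne_top_of_le_ne_top h (le_maxFun k y)

theorem combFun_eq_top_of_maxFun (hn : 1 ≤ n) (hl : ∀ k, 0 ≤ l k) {y : X}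
    (h : maxFun f y = ⊤) : combFun f l y = ⊤ := by
  have : Nonempty (Fin n) := ⟨⟨0, hn⟩⟩
  obtain ⟨k, hk⟩ := exists_eq_ciSup_of_finite (f := fun k => f k y)
  exact combFun_eq_top hl (k := k) (hk.trans h)

theorem combFun_le_maxFun (hl : l ∈ stdSimplex ℝ (Fin n)) (y : X) :
    combFun f l y ≤ maxFun f y := by
  obtain ⟨k, hk⟩ := exists_pos_of_mem_stdSimplex hl
  have hmax : ∀ k, f k y ≤ maxFun f y := fun k => le_maxFun k y
  by_cases ht : maxFun f y = ⊤
  · exact ht ▸ le_top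
  have hne := ne_top_of_maxFun_ne_top ht
  induction hM : maxFun f y with
  | top => exact absurd hM ht
  | bot => exact (combFun_eq_bot hl.1 hne hk (le_bot_iff.1 (hM ▸ hmax k))).le
  | coe M =>
    rw [combFun_eq_sum hl.1 hne]
    calc ∑ k, (l k : EReal) * f k y ≤ ∑ k, ((l k * M : ℝ) : EReal) :=
          Finset.sum_le_sum fun k _ => by
            rw [EReal.coe_mul]
            exact mul_le_mul_of_nonneg_left (hM ▸ hmax k) (EReal.coe_nonneg.2 (hl.1 k))
      _ = (M : EReal) := by rw [← coe_sum_ereal, ← Finset.sum_mul, hl.2, one_mul]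

theorem combFun_eq_bot_of_maxFun (hl : l ∈ stdSimplex ℝ (Fin n)) {y : X}
    (h : maxFun f y = ⊥) : combFun f l y = ⊥ :=
  le_bot_iff.1 (h ▸ combFun_le_maxFun hl y)

/-- A real bound for all real combinations above the values `f k y` is a bound for `combFun`. -/
theorem coe_le_combFun (hl : ∀ k, 0 ≤ l k) {y : X} {a : ℝ}
    (h : ∀ s : Fin n → ℝ, (∀ k, f k y ≤ s k) → a ≤ ∑ k, l k * s k) :
    (a : EReal) ≤ combFun f l y := by
  classical
  by_cases ht : ∃ k, f k y = ⊤
  · obtain ⟨k, hk⟩ := ht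
    exact combFun_eq_top hl hk ▸ le_top
  push Not at ht
  have hle : ∀ k, f k y ≤ ((f k y).toReal : EReal) := fun k => EReal.le_coe_toReal (ht k)
  by_cases hb : ∃ k, 0 < l k ∧ f k y = ⊥
  · exfalso
    obtain ⟨k, hk, hbk⟩ := hb
    set S := ∑ j ∈ Finset.univ.erase k, l j * (f j y).toReal
    -- The entry at `k` is unconstrained from below, so it is chosen to make the weighted sum `a -
    -- 1`.
    have := h (Function.update (fun j => (f j y).toReal) k ((a - 1 - S) / l k)) fun j => by
      rcases eq_or_ne j k with rfl | hj
      · rw [hbk]; exact bot_le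
      · rw [Function.update_of_ne hj]; exact hle j
    rw [← Finset.add_sum_erase _ _ (Finset.mem_univ k), Function.update_self,
      mul_div_cancel₀ _ hk.ne'] at this
    have hS : ∑ j ∈ Finset.univ.erase k, l j *
        Function.update (fun j => (f j y).toReal) k ((a - 1 - S) / l k) j = S :=
      Finset.sum_congr rfl fun j hj => by rw [Function.update_of_ne (Finset.ne_of_mem_erase hj)]
    linarith
  · push Not at hb
    rw [combFun_eq_sum hl ht]
    -- The value `-∞` survives only with weight zero, where replacing it by its `toReal` changes
    -- nothing.
    have hterm : ∀ k, (l k : EReal) * f k y = ((l k * (f k y).toReal : ℝ) : EReal) := fun k => by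
      rcases (hl k).eq_or_lt with h0 | h0
      · simp [← h0]
      · rw [EReal.coe_mul, EReal.coe_toReal (ht k) (hb k h0)]
    simp only [hterm, ← coe_sum_ereal]
    exact EReal.coe_le_coe_iff.2 (h _ hle)

end Combination

/-- A convex set of `Fin n → ℝ` that misses the open negative orthant admits a point of the
simplex whose linear functional is nonnegative on it. -/
theorem exists_stdSimplex_nonneg {n : ℕ} {C : Set (Fin n → ℝ)} (hC : Convex ℝ C)
    (hne : C.Nonempty) (hneg : ∀ r ∈ C, ∃ k, 0 ≤ r k) :
    ∃ l ∈ stdSimplex ℝ (Fin n), ∀ r ∈ C, 0 ≤ ∑ k, l k * r k := by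
  classical
  set N : Set (Fin n → ℝ) := Set.univ.pi fun _ => Set.Iio 0 with hN
  have hNo : IsOpen N := isOpen_set_pi Set.finite_univ fun _ _ => isOpen_Iio
  have hNc : Convex ℝ N := convex_pi fun _ _ => convex_Iio 0
  have hd : Disjoint N C := Set.disjoint_left.2 fun r hr hrC => by
    obtain ⟨k, hk⟩ := hneg r hrC
    exact absurd (hr k trivial) (not_lt.2 hk)
  obtain ⟨φ, u, hu, hφ⟩ := geometric_hahn_banach_open hNc hNo hC hd
  set m : Fin n → ℝ := fun k => φ (Pi.single k 1)
  have hrep : ∀ r, φ r = ∑ k, m k * r k := fun r => by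
    conv_lhs => rw [← Finset.univ_sum_single r]
    rw [map_sum]
    refine Finset.sum_congr rfl fun k _ => ?_
    have : (Pi.single k (r k) : Fin n → ℝ) = r k • Pi.single k (1 : ℝ) := by
      rw [← Pi.single_smul]; simp
    rw [this, map_smul, smul_eq_mul, mul_comm]
  -- The strict bound on the open orthant passes to its closure, which contains `0` and the negative
  -- half-axes.
  have hle : ∀ r, (∀ k, r k ≤ 0) → φ r ≤ u := fun r hr => by
    have hcl : r ∈ closure N := by
      rw [hN, closure_pi_set]
      intro k _
      rw [closure_Iio]
      exact hr k
    exact closure_minimal (fun a ha => (hu a ha).le) (isClosed_le φ.continuous continuous_const) hcl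
  have hu0 : 0 ≤ u := by simpa using hle 0 fun _ => le_rfl
  have hm : ∀ k, 0 ≤ m k := fun k => by
    by_contra! hk
    -- A negative `m k` puts this point in the closed orthant, yet `φ` equals `u + 1` there.
    have h := hle (((u + 1) / m k) • Pi.single k 1) fun j => by
      rcases eq_or_ne j k with rfl | hj
      · simpa using div_nonpos_of_nonneg_of_nonpos (by linarith) hk.le
      · simp [hj]
    rw [map_smul, smul_eq_mul, div_mul_cancel₀ _ hk.ne] at h
    linarith
  obtain ⟨c, hc⟩ := hne
  have hpos : 0 < ∑ k, m k := by
    refine (Finset.sum_nonneg fun k _ => hm k).lt_of_ne' fun h0 => ?_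
    have hz : ∀ k, m k = 0 := fun k =>
      (Finset.sum_eq_zero_iff_of_nonneg fun k _ => hm k).1 h0 k (Finset.mem_univ k)
    -- A zero functional cannot separate strictly: `0 < u` from the orthant, `u ≤ 0` from `C`.
    have h1 := hu (fun _ => -1) fun k _ => by simp
    have h2 := hφ c hc
    simp only [hrep, hz, zero_mul, Finset.sum_const_zero] at h1 h2
    linarith
  refine ⟨fun k => m k / ∑ k, m k, ⟨fun k => div_nonneg (hm k) hpos.le, ?_⟩, fun r hr => ?_⟩
  · rw [← Finset.sum_div, div_self hpos.ne']
  · have h := hφ r hr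
    rw [hrep] at h
    simp only [div_mul_eq_mul_div, ← Finset.sum_div]
    exact div_nonneg (hu0.trans h) hpos.le

/-! ### Affine minorants and subdifferentials -/

section Subdifferential

variable {X : Type*} [AddCommGroup X] [Module ℝ X]

/-- A real affine minorant of the maximum of finitely many convex functions minorizes one of
their convex combinations. -/
theorem exists_stdSimplex_le_combFun {n : ℕ} {f : Fin n → X → EReal}
    (hconv : ∀ k, IsConvexFun (f k)) (hdom : (edom (maxFun f)).Nonempty) (p : X →ₗ[ℝ] ℝ) (b : ℝ)
    (h : ∀ y, ((p y + b : ℝ) : EReal) ≤ maxFun f y) :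
    ∃ l ∈ stdSimplex ℝ (Fin n), ∀ y, ((p y + b : ℝ) : EReal) ≤ combFun f l y := by
  set C : Set (Fin n → ℝ) := {r | ∃ y, ∀ k, f k y ≤ ((r k + (p y + b) : ℝ) : EReal)}
  have hC : Convex ℝ C := by
    rintro r ⟨y, hy⟩ s ⟨z, hz⟩ α β hα hβ hαβ
    refine ⟨α • y + β • z, fun k => ?_⟩
    have h := hconv k (x := (y, r k + (p y + b))) (hy k) (y := (z, s k + (p z + b))) (hz k)
      hα hβ hαβ
    have h' : f k (α • y + β • z) ≤
      ((α * (r k + (p y + b)) + β * (s k + (p z + b)) : ℝ) : EReal) := h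
    refine h'.trans_eq (congrArg _ ?_)
    simp only [map_add, map_smul, smul_eq_mul, Pi.add_apply, Pi.smul_apply]
    linear_combination b * hαβ
  have hne : C.Nonempty := by
    obtain ⟨y, hy⟩ := hdom
    -- `toReal` sends `-∞` to `0`, still an upper bound.
    refine ⟨fun k => (f k y).toReal - (p y + b), y, fun k => ?_⟩
    rw [sub_add_cancel]
    exact EReal.le_coe_toReal (ne_top_of_maxFun_ne_top (ne_of_lt hy) k)
  have hneg : ∀ r ∈ C, ∃ k, 0 ≤ r k := by
    rintro r ⟨y, hy⟩
    by_contra! hr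
    have hlt : maxFun f y < ((p y + b : ℝ) : EReal) := by
      rcases isEmpty_or_nonempty (Fin n) with hn | hn
      · simp [maxFun]
      obtain ⟨k, hk⟩ := exists_eq_ciSup_of_finite (f := fun k => f k y)
      calc maxFun f y = f k y := hk.symm
        _ ≤ _ := hy k
        _ < _ := EReal.coe_lt_coe_iff.2 (by linarith [hr k])
    exact absurd (h y) (not_le.2 hlt)
  obtain ⟨l, hl, hlC⟩ := exists_stdSimplex_nonneg hC hne hneg
  refine ⟨l, hl, fun y => coe_le_combFun hl.1 fun s hs => ?_⟩
  have h0 := hlC (fun k => s k - (p y + b)) ⟨y, fun k => by rw [sub_add_cancel]; exact hs k⟩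
  simp only [mul_sub, Finset.sum_sub_distrib, ← Finset.sum_mul, hl.2, one_mul] at h0
  linarith

variable [TopologicalSpace X] {g : X → EReal} {x : X} {p : X →L[ℝ] ℝ}

theorem mem_epsSubdiff_of_coe {c ε : ℝ} (hc : g x = c) :
    p ∈ epsSubdiff (ε : EReal) g x ↔
      0 ≤ ε ∧ ∀ y, ((c + p (y - x) - ε : ℝ) : EReal) ≤ g y := by
  have hx : x ∈ edom g := by simp [edom, hc, EReal.coe_lt_top]
  simp only [epsSubdiff, Set.mem_ofPred_eq, hx, hc, true_and, ← EReal.coe_neg, eadd_coe,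
    EReal.coe_nonneg, ← sub_eq_add_neg]

theorem mem_epsSubdiff_of_bot {ε : EReal} (hx : g x = ⊥) (hε : 0 ≤ ε) :
    p ∈ epsSubdiff ε g x := by
  refine ⟨by simp [edom, hx], hε, fun y => ?_⟩
  rw [hx, eadd_bot (EReal.coe_ne_top _), eadd_bot]
  · exact bot_le
  · rw [Ne, EReal.neg_eq_top_iff]
    rintro rfl
    simp at hε

theorem notMem_epsSubdiff_of_top {ε : EReal} (hx : g x = ⊤) : p ∉ epsSubdiff ε g x :=
  fun h => absurd h.1 (by simp [edom, hx])

theorem mem_epsSubdiff_maxFun_of_coe {n : ℕ} {f : Fin n → X → EReal}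
    (hconv : ∀ k, IsConvexFun (f k)) {c ε : ℝ} (hc : maxFun f x = c) (hε : 0 ≤ ε) :
    p ∈ epsSubdiff (ε : EReal) (maxFun f) x ↔
      ∃ l ∈ stdSimplex ℝ (Fin n), ∀ y, ((c + p (y - x) - ε : ℝ) : EReal) ≤ combFun f l y := by
  rw [mem_epsSubdiff_of_coe hc]
  constructor
  · rintro ⟨-, h⟩
    have e : ∀ y, c + p (y - x) - ε = (p : X →ₗ[ℝ] ℝ) y + (c - p x - ε) := fun y => by
      rw [map_sub, ContinuousLinearMap.coe_coe]; ring
    simp only [e] at h ⊢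
    exact exists_stdSimplex_le_combFun hconv ⟨x, by simp [edom, hc, EReal.coe_lt_top]⟩ _ _ h
  · rintro ⟨l, hl, h⟩
    exact ⟨hε, fun y => (h y).trans (combFun_le_maxFun hl y)⟩

theorem mem_epsSubdiff_combFun_of_coe {n : ℕ} {f : Fin n → X → EReal} {l : Fin n → ℝ}
    (hl : l ∈ stdSimplex ℝ (Fin n)) {c ε : ℝ} (hc : maxFun f x = c) :
    p ∈ epsSubdiff (eadd (eadd (ε : EReal) (combFun f l x)) (-(maxFun f x))) (combFun f l) x ↔
      ∀ y, ((c + p (y - x) - ε : ℝ) : EReal) ≤ combFun f l y := by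
  have hle := hc ▸ combFun_le_maxFun (f := f) hl x
  rw [hc, ← EReal.coe_neg]
  induction hb : combFun f l x with
  | top => exact absurd (hb ▸ hle) (not_le.2 (EReal.coe_lt_top c))
  | bot =>
    refine iff_of_false (fun h => absurd h.2.1 ?_) fun h => absurd (hb ▸ h x) (not_le.2 (EReal.bot_lt_coe _))
    rw [eadd_of_ne_top (EReal.coe_ne_top ε) bot_ne_top, EReal.add_bot,
      eadd_bot (EReal.coe_ne_top _)]
    simp
  | coe b =>
    rw [eadd_coe, eadd_coe, mem_epsSubdiff_of_coe hb]
    have e : ∀ y, b + p (y - x) - (ε + b + -c) = c + p (y - x) - ε := fun y => by ring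
    simp only [e, and_iff_right_iff_imp]
    intro h
    have hx := EReal.coe_le_coe_iff.1 (hb ▸ h x)
    rw [sub_self, map_zero] at hx
    linarith

/-- At `y = x` the minorant inequality gives `f x ≤ f_λ x`, hence equality. -/
theorem mem_subdiff_combFun_of_coe {n : ℕ} {f : Fin n → X → EReal} {l : Fin n → ℝ}
    (hl : l ∈ stdSimplex ℝ (Fin n)) {c : ℝ} (hc : maxFun f x = c) :
    combFun f l x = maxFun f x ∧ p ∈ subdiff (combFun f l) x ↔
      ∀ y, ((c + p (y - x) - 0 : ℝ) : EReal) ≤ combFun f l y := by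
  rw [subdiff, ← EReal.coe_zero]
  constructor
  · rintro ⟨he, h⟩
    exact ((mem_epsSubdiff_of_coe (he.trans hc)).1 h).2
  · intro h
    have he : combFun f l x = maxFun f x := by
      refine le_antisymm (combFun_le_maxFun hl x) ?_
      simpa [hc] using h x
    exact ⟨he, (mem_epsSubdiff_of_coe (he.trans hc)).2 ⟨le_rfl, h⟩⟩

end Subdifferential

end MaxSubdiff

open MaxSubdiff in
theorem mainTheorem5 {X : Type*} [AddCommGroup X] [Module ℝ X] [TopologicalSpace X]
    [IsTopologicalAddGroup X] [ContinuousSMul ℝ X] [LocallyConvexSpace ℝ X] [T2Space X]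
    (n : ℕ) (hn : 1 ≤ n) (f : Fin n → X → EReal)
    (hconv : ∀ k, MaxSubdiff.IsConvexFun (f k))
    (hdom : (MaxSubdiff.edom (MaxSubdiff.maxFun f)).Nonempty)
    (hf : (∀ k, MaxSubdiff.IsProper (f k)) ∨ (∀ k, MaxSubdiff.IsLsc (f k)))
    (x : X) :
    (∀ ε : ℝ, 0 ≤ ε →
      MaxSubdiff.epsSubdiff (ε : EReal) (MaxSubdiff.maxFun f) x =
        ⋃ l ∈ stdSimplex ℝ (Fin n),
          MaxSubdiff.epsSubdiff
            (MaxSubdiff.eadd (MaxSubdiff.eadd (ε : EReal) (MaxSubdiff.combFun f l x))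
              (-(MaxSubdiff.maxFun f x)))
            (MaxSubdiff.combFun f l) x) ∧
    MaxSubdiff.subdiff (MaxSubdiff.maxFun f) x =
      ⋃ l ∈ {l | l ∈ stdSimplex ℝ (Fin n) ∧
          MaxSubdiff.combFun f l x = MaxSubdiff.maxFun f x},
        MaxSubdiff.subdiff (MaxSubdiff.combFun f l) x := by
  have hsimplex : ∃ l, l ∈ stdSimplex ℝ (Fin n) := ⟨_, single_mem_stdSimplex ℝ (⟨0, hn⟩ : Fin n)⟩
  constructor
  · intro ε hε
    ext p
    simp only [Set.mem_iUnion, exists_prop]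
    induction hx : maxFun f x with
    | top =>
      refine iff_of_false (notMem_epsSubdiff_of_top hx) ?_
      rintro ⟨l, hl, h⟩
      exact notMem_epsSubdiff_of_top (combFun_eq_top_of_maxFun hn hl.1 hx) h
    | bot =>
      obtain ⟨l, hl⟩ := hsimplex
      refine iff_of_true (mem_epsSubdiff_of_bot hx (EReal.coe_nonneg.2 hε)) ⟨l, hl, ?_⟩
      refine mem_epsSubdiff_of_bot (combFun_eq_bot_of_maxFun hl hx) ?_
      -- Here `(-∞) + (+∞) = +∞` makes the parameter `+∞`, so it is nonnegative.
      rw [EReal.neg_bot, eadd_eq_top.2 (Or.inr rfl)]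
      exact le_top
    | coe c =>
      rw [mem_epsSubdiff_maxFun_of_coe hconv hx hε, ← hx]
      exact exists_congr fun l => and_congr_right fun hl =>
        (mem_epsSubdiff_combFun_of_coe hl hx).symm
  · ext p
    simp only [Set.mem_iUnion, exists_prop, Set.mem_ofPred_eq, and_assoc]
    induction hx : maxFun f x with
    | top =>
      refine iff_of_false (notMem_epsSubdiff_of_top hx) ?_
      rintro ⟨l, hl, -, h⟩
      exact notMem_epsSubdiff_of_top (combFun_eq_top_of_maxFun hn hl.1 hx) h
    | bot =>
      obtain ⟨l, hl⟩ := hsimplex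
      have hb := combFun_eq_bot_of_maxFun hl hx
      exact iff_of_true (mem_epsSubdiff_of_bot hx le_rfl)
        ⟨l, hl, hb, mem_epsSubdiff_of_bot hb le_rfl⟩
    | coe c =>
      rw [subdiff, ← EReal.coe_zero, mem_epsSubdiff_maxFun_of_coe hconv hx le_rfl, ← hx]
      exact exists_congr fun l => and_congr_right fun hl =>
        (mem_subdiff_combFun_of_coe hl hx).symm
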